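/- Let $M$ be a smooth manifold (finite-dimensional, Hausdorff, second countable, without boundary) and let $\mathbf d=(d_1,\dots,d_k)$ be non-negative integers, with $k\ge 0$. Let $\mathbb R^{\mathbf d}=\mathbb R^{d_1}\times\cdots\times\mathbb R^{d_k}$, where the coordinates on the factor $\mathbb R^{d_w}$ are assigned the weight $w$. The weight of a monomial is the sum of the weights of its factors, and the degree of a polynomial is the largest weight of its non-zero monomials. A \emph{filtered bundle} of rank $\mathbf d$ over $M$ is a smooth fibre bundle $\pi:\mathcal F\to M$ with typical fibre $\mathbb R^{\mathbf d}$, together with a bundle atlas in which every change of fibre coordinates expresses each new coordinate of weight $w$ as a polynomial of degree at most $w$ in the old fibre coordinates, with coefficients that are smooth functions of the base point. A fibrewise map between filtered bundles over $M$, covering $\mathrm{id}_M$, is a \emph{filtered morphism} if in such coordinates each target coordinate of weight $w$ is a polynomial of degree at most $w$ in the source fibre coordinates, with coefficients smooth on the base. A \emph{filtered isomorphism} is a fibrewise bijection which, together with its inverse, is a filtered morphism. A \emph{split graded bundle} of rank $\mathbf d$ over $M$ is a Whitney sum $V=V_1\oplus_M\cdots\oplus_M V_k$ of smooth vector bundles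 $V_w\to M$ of rank $d_w$, with the fibre coordinates of $V_w$ in weight $w$; its homogeneity structure is $h_t(v_1,\dots,v_k)=(t v_1,\dots,t^k v_k)$, $t\in\mathbb R$. \textbf{Theorem (Bachelor--Gawędzki-like theorem).} Let $\mathcal F$ be a filtered bundle of rank $\mathbf d$ over $M$. (1) There are smooth vector bundles $V_1,\dots,V_k$ over $M$, with $V_w$ of rank $d_w$, and a filtered isomorphism $\mathcal F\cong V_1\oplus_M\cdots\oplus_M V_k$ covering $\mathrm{id}_M$. (2) Such an isomorphism is not canonical: if $M\neq\emptyset$ and some $d_w>0$, then for every filtered isomorphism $\Phi:\mathcal F\to V$ covering $\mathrm{id}_M$ onto a split graded bundle $V$ of rank $\mathbf d$, there is a filtered automorphism $\varphi$ of $\mathcal F$ covering $\mathrm{id}_M$ such that $\Phi\circ\varphi\circ\Phi^{-1}$ does not commute with the homogeneity structure $(h_t)_{t\in\mathbb R}$ of $V$; that is, the graded structure induced on $\mathcal F$ by $\Phi$ is not preserved by all filtered automorphisms of $\mathcal F$. -/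

import Mathlib

open Bundle Set Topology
open scoped Manifold ContDiff

/-- The typical fibre `ℝ^{d 0} × ⋯ × ℝ^{d (k-1)}`.  The coordinates on the `i`-th factor
(`i : Fin k`) have weight `i + 1`, so the weights run through `1, …, k`. -/
abbrev GradedModel {k : ℕ} (d : Fin k → ℕ) : Type := ∀ i : Fin k, Fin (d i) → ℝ

/-- Labels of the fibre coordinates. -/
abbrev CoordIndex {k : ℕ} (d : Fin k → ℕ) : Type := Σ i : Fin k, Fin (d i)

/-- The weight of a fibre coordinate. -/
def coordWeight {k : ℕ} (d : Fin k → ℕ) (j : CoordIndex d) : ℕ := (j.1 : ℕ) + 1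

/-- A family of maps between typical fibres, parametrised by `x ∈ U`, is *filtered* if each target
coordinate of weight `w` is a polynomial of weighted degree at most `w` in the source coordinates,
with coefficients that are smooth functions of `x ∈ U`. -/
def IsFilteredFamily (m : ℕ) {M : Type*} [TopologicalSpace M]
    [ChartedSpace (EuclideanSpace ℝ (Fin m)) M] {k l : ℕ} {d : Fin k → ℕ} {d' : Fin l → ℕ}
    (U : Set M) (T : M → GradedModel d → GradedModel d') : Prop :=
  ∀ (i : Fin l) (a : Fin (d' i)), ∃ p : M → MvPolynomial (CoordIndex d) ℝ,
    (∀ x ∈ U, (p x).weightedTotalDegree (coordWeight d) ≤ coordWeight d' ⟨i, a⟩) ∧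
    (∀ n : CoordIndex d →₀ ℕ,
      ContMDiffOn (𝓡 m) 𝓘(ℝ, ℝ) ∞ (fun x => (p x).coeff n) U) ∧
    ∀ x ∈ U, ∀ X : GradedModel d,
      T x X i a = MvPolynomial.eval (fun j : CoordIndex d => X j.1 j.2) (p x)

/-- A *filtered bundle* of rank `d = (d 0, …, d (k-1))` over the smooth manifold `M`: a fibre bundle
with typical fibre `GradedModel d` and a bundle atlas whose changes of fibre coordinates are
polynomial, respect the weighted degree, and depend smoothly on the base point. -/
class FilteredBundle (m : ℕ) {M : Type*} [TopologicalSpace M]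
    [ChartedSpace (EuclideanSpace ℝ (Fin m)) M] {k : ℕ} (d : Fin k → ℕ) (E : M → Type*)
    [TopologicalSpace (TotalSpace (GradedModel d) E)] [∀ x, TopologicalSpace (E x)]
    [FiberBundle (GradedModel d) E] : Prop where
  filtered_coordChange : ∀ (e e' : Trivialization (GradedModel d) (π (GradedModel d) E))
    [MemTrivializationAtlas e] [MemTrivializationAtlas e'],
    IsFilteredFamily m (e.baseSet ∩ e'.baseSet) (fun x X => e.coordChange e' x X)

/-- A morphism of filtered bundles covering the identity of the base: a fibrewise map which, in
adapted coordinates, is polynomial, respects the weighted degree, and has coefficients that are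
smooth functions on the base. -/
def IsFilteredMorphism (m : ℕ) {M : Type*} [TopologicalSpace M]
    [ChartedSpace (EuclideanSpace ℝ (Fin m)) M] {k l : ℕ} (d : Fin k → ℕ) (d' : Fin l → ℕ)
    {E : M → Type*} {E' : M → Type*}
    [TopologicalSpace (TotalSpace (GradedModel d) E)] [∀ x, TopologicalSpace (E x)]
    [FiberBundle (GradedModel d) E]
    [TopologicalSpace (TotalSpace (GradedModel d') E')] [∀ x, TopologicalSpace (E' x)]
    [FiberBundle (GradedModel d') E'] (Φ : ∀ x, E x → E' x) : Prop :=
  ∀ (e : Trivialization (GradedModel d) (π (GradedModel d) E))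
    (e' : Trivialization (GradedModel d') (π (GradedModel d') E'))
    [MemTrivializationAtlas e] [MemTrivializationAtlas e'],
    IsFilteredFamily m (e.baseSet ∩ e'.baseSet) (fun x X =>
      let q := e.toOpenPartialHomeomorph.symm (x, X)
      (e' ⟨q.proj, Φ q.proj q.snd⟩).2)

/-- An isomorphism of filtered bundles covering the identity of the base. -/
structure FilteredIso (m : ℕ) {M : Type*} [TopologicalSpace M]
    [ChartedSpace (EuclideanSpace ℝ (Fin m)) M] {k l : ℕ} (d : Fin k → ℕ) (d' : Fin l → ℕ)
    (E : M → Type*) (E' : M → Type*)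
    [TopologicalSpace (TotalSpace (GradedModel d) E)] [∀ x, TopologicalSpace (E x)]
    [FiberBundle (GradedModel d) E]
    [TopologicalSpace (TotalSpace (GradedModel d') E')] [∀ x, TopologicalSpace (E' x)]
    [FiberBundle (GradedModel d') E'] where
  toEquiv : ∀ x, E x ≃ E' x
  filtered_toEquiv : IsFilteredMorphism m d d' (fun x => toEquiv x)
  filtered_symm : IsFilteredMorphism m d' d (fun x => (toEquiv x).symm)

/-- A smooth real vector bundle of rank `r` over `M`. -/
structure SmoothVectorBundle (m : ℕ) (M : Type*) [TopologicalSpace M]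
    [ChartedSpace (EuclideanSpace ℝ (Fin m)) M] (r : ℕ) where
  Fiber : M → Type
  [addCommGroup : ∀ x, AddCommGroup (Fiber x)]
  [module : ∀ x, Module ℝ (Fiber x)]
  [topTotal : TopologicalSpace (TotalSpace (Fin r → ℝ) Fiber)]
  [topFiber : ∀ x, TopologicalSpace (Fiber x)]
  [fiberBundle : FiberBundle (Fin r → ℝ) Fiber]
  [vectorBundle : VectorBundle ℝ (Fin r → ℝ) Fiber]
  [smooth : ContMDiffVectorBundle ∞ (Fin r → ℝ) Fiber (𝓡 m)]

attribute [instance] SmoothVectorBundle.addCommGroup SmoothVectorBundle.module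
  SmoothVectorBundle.topTotal SmoothVectorBundle.topFiber SmoothVectorBundle.fiberBundle
  SmoothVectorBundle.vectorBundle SmoothVectorBundle.smooth

section Whitney

variable {m : ℕ} {M : Type*} [TopologicalSpace M] [ChartedSpace (EuclideanSpace ℝ (Fin m)) M]
  {k : ℕ} {d : Fin k → ℕ}

/-- The fibres of the Whitney sum `V 0 ⊕ ⋯ ⊕ V (k-1)`. -/
def WhitneySum (V : ∀ i : Fin k, SmoothVectorBundle m M (d i)) (x : M) : Type :=
  ∀ i, (V i).Fiber x

variable (V : ∀ i : Fin k, SmoothVectorBundle m M (d i))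

instance WhitneySum.instAddCommGroup (x : M) : AddCommGroup (WhitneySum V x) :=
  inferInstanceAs (AddCommGroup (∀ i, (V i).Fiber x))

instance WhitneySum.instModule (x : M) : Module ℝ (WhitneySum V x) :=
  inferInstanceAs (Module ℝ (∀ i, (V i).Fiber x))

instance WhitneySum.instTopologicalSpace (x : M) : TopologicalSpace (WhitneySum V x) :=
  inferInstanceAs (TopologicalSpace (∀ i, (V i).Fiber x))

/-- The inclusion of the total space of the Whitney sum into the product of the base and the total
spaces of the summands. -/
def WhitneySum.diag (p : TotalSpace (GradedModel d) (WhitneySum V)) :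
    M × ∀ i, TotalSpace (Fin (d i) → ℝ) (V i).Fiber :=
  (p.1, fun i => ⟨p.1, p.2 i⟩)

instance WhitneySum.instTopologicalSpaceTotal :
    TopologicalSpace (TotalSpace (GradedModel d) (WhitneySum V)) :=
  TopologicalSpace.induced (WhitneySum.diag V) inferInstance

theorem WhitneySum.isInducing_diag : IsInducing (WhitneySum.diag V) := ⟨rfl⟩

variable {V}

/-- The trivialization of the Whitney sum built from trivializations of the summands. -/
noncomputable def WhitneySum.triv
    (e : ∀ i, Trivialization (Fin (d i) → ℝ) (π (Fin (d i) → ℝ) (V i).Fiber)) :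
    Trivialization (GradedModel d) (π (GradedModel d) (WhitneySum V)) where
  toFun p := (p.1, fun i => (e i ⟨p.1, p.2 i⟩).2)
  invFun p := ⟨p.1, fun i => (e i).symm p.1 (p.2 i)⟩
  source := π (GradedModel d) (WhitneySum V) ⁻¹' ⋂ i, (e i).baseSet
  target := (⋂ i, (e i).baseSet) ×ˢ univ
  baseSet := ⋂ i, (e i).baseSet
  map_source' x hx := ⟨hx, mem_univ _⟩
  map_target' x hx := hx.1
  left_inv' := by
    rintro ⟨x, v⟩ hx
    have hx' : ∀ i, x ∈ (e i).baseSet := mem_iInter.1 hx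
    refine congrArg (TotalSpace.mk x) (funext fun i => ?_)
    exact (e i).symm_apply_apply_mk (hx' i) (v i)
  right_inv' := by
    rintro ⟨x, v⟩ hx
    have hx' : ∀ i, x ∈ (e i).baseSet := mem_iInter.1 hx.1
    refine Prod.ext rfl (funext fun i => ?_)
    exact congrArg Prod.snd ((e i).apply_mk_symm (hx' i) (v i))
  open_source := by
    have h : Continuous fun p : TotalSpace (GradedModel d) (WhitneySum V) => p.1 :=
      continuous_fst.comp (WhitneySum.isInducing_diag V).continuous
    exact (isOpen_iInter_of_finite fun i => (e i).open_baseSet).preimage h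
  open_target := (isOpen_iInter_of_finite fun i => (e i).open_baseSet).prod isOpen_univ
  continuousOn_toFun := by
    have hd := (WhitneySum.isInducing_diag V).continuous
    refine (continuous_fst.comp hd).continuousOn.prodMk (continuousOn_pi.2 fun i => ?_)
    have hi : Continuous fun p : TotalSpace (GradedModel d) (WhitneySum V) =>
        (⟨p.1, p.2 i⟩ : TotalSpace (Fin (d i) → ℝ) (V i).Fiber) :=
      (continuous_apply i).comp (continuous_snd.comp hd)
    refine continuous_snd.comp_continuousOn ((e i).continuousOn.comp hi.continuousOn ?_)
    intro p hp
    exact (e i).mem_source.2 (mem_iInter.1 hp i)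
  continuousOn_invFun := by
    rw [(WhitneySum.isInducing_diag V).continuousOn_iff]
    refine continuous_fst.continuousOn.prodMk (continuousOn_pi.2 fun i => ?_)
    have hi : Continuous fun p : M × GradedModel d => (p.1, p.2 i) := by fun_prop
    refine (e i).continuousOn_symm.comp hi.continuousOn ?_
    intro p hp
    exact ⟨mem_iInter.1 hp.1 i, mem_univ _⟩
  open_baseSet := isOpen_iInter_of_finite fun i => (e i).open_baseSet
  source_eq := rfl
  target_eq := rfl
  proj_toFun _ _ := rfl

variable (V)

noncomputable instance WhitneySum.instFiberBundle :
    FiberBundle (GradedModel d) (WhitneySum V) where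
  totalSpaceMk_isInducing' x := by
    have h : IsInducing (WhitneySum.diag V ∘
        (TotalSpace.mk x : WhitneySum V x → TotalSpace (GradedModel d) (WhitneySum V))) := by
      have h2 : IsInducing (Pi.map fun i => (TotalSpace.mk x :
          (V i).Fiber x → TotalSpace (Fin (d i) → ℝ) (V i).Fiber)) :=
        IsInducing.piMap fun i =>
          FiberBundle.totalSpaceMk_isInducing (Fin (d i) → ℝ) (V i).Fiber x
      exact (isInducing_const_prod (x := x)).2 h2
    exact (WhitneySum.isInducing_diag V).of_comp_iff.1 h
  trivializationAtlas' := {e | ∃ e' : ∀ i, Trivialization (Fin (d i) → ℝ)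
      (π (Fin (d i) → ℝ) (V i).Fiber),
    (∀ i, MemTrivializationAtlas (e' i)) ∧ e = WhitneySum.triv e'}
  trivializationAt' x :=
    WhitneySum.triv fun i => trivializationAt (Fin (d i) → ℝ) (V i).Fiber x
  mem_baseSet_trivializationAt' x :=
    mem_iInter.2 fun i => mem_baseSet_trivializationAt (Fin (d i) → ℝ) (V i).Fiber x
  trivialization_mem_atlas' x := ⟨_, fun _ => inferInstance, rfl⟩

/-- With the coordinates of `V i` in weight `i + 1`, the Whitney sum is a filtered bundle. -/
instance WhitneySum.instFilteredBundle : FilteredBundle m d (WhitneySum V) where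
  filtered_coordChange := by
    rintro _ _ ⟨e, he, rfl⟩ ⟨e', he', rfl⟩ i a
    have hU : (WhitneySum.triv e).baseSet ∩ (WhitneySum.triv e').baseSet ⊆
        (e i).baseSet ∩ (e' i).baseSet := fun x hx =>
      ⟨mem_iInter.1 hx.1 i, mem_iInter.1 hx.2 i⟩
    have hei := he i
    have hei' := he' i
    refine ⟨fun x => ∑ b : Fin (d i), MvPolynomial.monomial (Finsupp.single ⟨i, b⟩ 1)
      ((e i).coordChangeL ℝ (e' i) x (Pi.single b 1) a), fun x _ => ?_, fun n => ?_,
      fun x hx X => ?_⟩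
    · rw [MvPolynomial.weightedTotalDegree, Finset.sup_le_iff]
      intro s hs
      obtain ⟨b, -, hb⟩ := Finset.mem_biUnion.1 (MvPolynomial.support_sum hs)
      have := Finset.mem_singleton.1 (MvPolynomial.support_monomial_subset hb)
      subst this
      simp [Finsupp.weight_single, coordWeight]
    · simp only [MvPolynomial.coeff_sum, MvPolynomial.coeff_monomial]
      refine contMDiffOn_finsetSum fun b _ => ?_
      split_ifs
      · have h := (contMDiffOn_coordChangeL (n := ∞) (IB := 𝓡 m) (e i) (e' i)).mono hU
        have h1 : ContMDiffOn (𝓡 m) 𝓘(ℝ, Fin (d i) → ℝ) ∞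
            (fun x => ((e i).coordChangeL ℝ (e' i) x : (Fin (d i) → ℝ) →L[ℝ] (Fin (d i) → ℝ))
              (Pi.single b 1))
            ((WhitneySum.triv e).baseSet ∩ (WhitneySum.triv e').baseSet) :=
          h.clm_apply contMDiffOn_const
        exact (contMDiffOn_pi_space.1 h1) a
      · exact contMDiffOn_const
    · have h1 : (WhitneySum.triv e).coordChange (WhitneySum.triv e') x X i =
          (e i).coordChangeL ℝ (e' i) x (X i) :=
        ((e i).coordChangeL_apply (e' i) (hU hx) (X i)).symm
      have h2 := congrFun h1 a
      rw [pi_eq_sum_univ' (X i)] at h2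
      refine h2.trans ?_
      simp [map_sum, Finset.sum_apply, MvPolynomial.eval_monomial, mul_comm]

variable {V}

/-- The homogeneity structure of the split graded bundle `V 0 ⊕ ⋯ ⊕ V (k-1)`, with `V i` in weight
`i + 1`: multiplication by `t ^ (i + 1)` on the `i`-th summand. -/
def WhitneySum.homogeneity (t : ℝ) {x : M} (v : WhitneySum V x) : WhitneySum V x :=
  fun i => t ^ ((i : ℕ) + 1) • v i

/-- A fibrewise self-map of a split graded bundle preserves the grading if it commutes with the
homogeneity structure. -/
def WhitneySum.IsGraded (Ψ : ∀ x, WhitneySum V x → WhitneySum V x) : Prop :=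
  ∀ (x : M) (t : ℝ) (v : WhitneySum V x),
    Ψ x (WhitneySum.homogeneity t v) = WhitneySum.homogeneity t (Ψ x v)

end Whitney

/-! A polynomial of degree at most `w`, all of whose variables have positive weight, can contain a
variable of weight at least `w` only as a linear term in a variable of weight exactly `w`. So every
filtered coordinate change is block triangular: its weight-`w` component is `A_w(x) X_w` plus a
function of the coordinates of smaller weight (`IsFilteredFamily.sub_eq_diagPart`). The blocks `A_w`
are multiplicative under composition (`diagPart_comp`), hence form smooth cocycles, and these define
the vector bundles `V_w` (`gradedCore`).

Each trivialization of the filtered bundle identifies it locally with the sum of the `V_w`. Since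
the `V_w` are linear, these local identifications can be averaged with a partition of unity. In any
chart each of them has the form `X_w` plus lower terms, and this form survives averaging because the
weights sum to one (`isUnipotent_splittingRep`). A map of this form has an inverse built from it by
finitely many compositions, sums and differences, so the inverse is filtered too
(`IsFilteredFamily.unipotentInv`). This gives `splittingIso`.

For non-canonicity, translation by a section is filtered, as constants have degree 0, whereas a map
commuting with `h_0 = 0` must fix the zero section. A translation that is nonzero at one point,
conjugated by the given isomorphism, is the required automorphism. -/

/-! ### Algebra of weighted polynomials with smooth coefficients -/

section FilteredFunctions

variable {m : ℕ} {M : Type*} [TopologicalSpace M] [ChartedSpace (EuclideanSpace ℝ (Fin m)) M]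
  {k l : ℕ} {d : Fin k → ℕ} {d' : Fin l → ℕ} {U V : Set M} {w w' : ℕ}
  {f g : M → GradedModel d → ℝ}

/-- A function on `U × GradedModel d` which is polynomial of weighted degree at most `w` in the
fibre coordinates, with coefficients smooth on `U`. -/
def IsFilteredFunction (m : ℕ) {M : Type*} [TopologicalSpace M]
    [ChartedSpace (EuclideanSpace ℝ (Fin m)) M] {k : ℕ} {d : Fin k → ℕ}
    (U : Set M) (w : ℕ) (f : M → GradedModel d → ℝ) : Prop :=
  ∃ p : M → MvPolynomial (CoordIndex d) ℝ,
    (∀ x ∈ U, (p x).weightedTotalDegree (coordWeight d) ≤ w) ∧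
    (∀ n : CoordIndex d →₀ ℕ, ContMDiffOn (𝓡 m) 𝓘(ℝ, ℝ) ∞ (fun x => (p x).coeff n) U) ∧
    ∀ x ∈ U, ∀ X : GradedModel d,
      f x X = MvPolynomial.eval (fun j : CoordIndex d => X j.1 j.2) (p x)

theorem weightedTotalDegree_le_iff {σ R : Type*} [CommSemiring R] {wt : σ → ℕ}
    {p : MvPolynomial σ R} {w : ℕ} :
    p.weightedTotalDegree wt ≤ w ↔ ∀ n, p.coeff n ≠ 0 → Finsupp.weight wt n ≤ w := by
  simp [MvPolynomial.weightedTotalDegree]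

namespace IsFilteredFunction

theorem congr (hf : IsFilteredFunction m U w f) (h : ∀ x ∈ U, ∀ X, g x X = f x X) :
    IsFilteredFunction m U w g := by
  obtain ⟨p, h1, h2, h3⟩ := hf
  exact ⟨p, h1, h2, fun x hx X => (h x hx X).trans (h3 x hx X)⟩

theorem mono (hf : IsFilteredFunction m U w f) (hV : V ⊆ U) (hw : w ≤ w') :
    IsFilteredFunction m V w' f := by
  obtain ⟨p, h1, h2, h3⟩ := hf
  exact ⟨p, fun x hx => (h1 x (hV hx)).trans hw, fun n => (h2 n).mono hV,
    fun x hx => h3 x (hV hx)⟩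

theorem monomial {c : M → ℝ} (hc : ContMDiffOn (𝓡 m) 𝓘(ℝ, ℝ) ∞ c U) {n : CoordIndex d →₀ ℕ}
    (hn : Finsupp.weight (coordWeight d) n ≤ w) :
    IsFilteredFunction m U w (fun x X : _ => c x * ∏ j : CoordIndex d, X j.1 j.2 ^ n j) := by
  classical
  refine ⟨fun x => MvPolynomial.monomial n (c x), fun x _ => ?_, fun n' => ?_, fun x _ X => ?_⟩
  · rw [weightedTotalDegree_le_iff]
    intro n' h
    rw [MvPolynomial.coeff_monomial] at h
    obtain rfl : n = n' := by
      by_contra hne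
      simp [hne] at h
    exact hn
  · simp only [MvPolynomial.coeff_monomial]
    split_ifs
    · exact hc
    · exact contMDiffOn_const
  · rw [MvPolynomial.eval_monomial, Finsupp.prod_fintype _ _ fun _ => pow_zero _]

theorem base {c : M → ℝ} (hc : ContMDiffOn (𝓡 m) 𝓘(ℝ, ℝ) ∞ c U) (w : ℕ) :
    IsFilteredFunction m U w (fun x (_ : GradedModel d) => c x) :=
  (monomial hc (n := 0) (by simp)).congr fun x _ X => by simp

theorem coord (j : CoordIndex d) :
    IsFilteredFunction m U (coordWeight d j) (fun (_ : M) (X : GradedModel d) => X j.1 j.2) :=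
  (monomial (contMDiffOn_const (c := (1 : ℝ))) (n := Finsupp.single j 1)
    (by simp [Finsupp.weight_single])).congr fun x _ X => by
      classical
      simp [Finsupp.single_apply, Finset.prod_ite_eq]

theorem add (hf : IsFilteredFunction m U w f) (hg : IsFilteredFunction m U w g) :
    IsFilteredFunction m U w (fun x X => f x X + g x X) := by
  obtain ⟨p, h1, h2, h3⟩ := hf
  obtain ⟨q, g1, g2, g3⟩ := hg
  refine ⟨fun x => p x + q x, fun x hx => ?_, fun n => ?_, fun x hx X => ?_⟩
  · rw [weightedTotalDegree_le_iff]
    intro n hn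
    by_cases hp : (p x).coeff n = 0
    · refine weightedTotalDegree_le_iff.1 (g1 x hx) n fun hq => hn ?_
      simp [hp, hq]
    · exact weightedTotalDegree_le_iff.1 (h1 x hx) n hp
  · simp only [MvPolynomial.coeff_add]
    exact (h2 n).add (g2 n)
  · simp [h3 x hx, g3 x hx]

theorem mul (hf : IsFilteredFunction m U w f) (hg : IsFilteredFunction m U w' g) :
    IsFilteredFunction m U (w + w') (fun x X => f x X * g x X) := by
  classical
  obtain ⟨p, h1, h2, h3⟩ := hf
  obtain ⟨q, g1, g2, g3⟩ := hg
  refine ⟨fun x => p x * q x, fun x hx => ?_, fun n => ?_, fun x hx X => ?_⟩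
  · rw [weightedTotalDegree_le_iff]
    intro n hn
    rw [MvPolynomial.coeff_mul] at hn
    obtain ⟨⟨a, b⟩, hab, hne⟩ := Finset.exists_ne_zero_of_sum_ne_zero hn
    rw [← Finset.HasAntidiagonal.mem_antidiagonal.1 hab, map_add]
    exact add_le_add (weightedTotalDegree_le_iff.1 (h1 x hx) a (left_ne_zero_of_mul hne))
      (weightedTotalDegree_le_iff.1 (g1 x hx) b (right_ne_zero_of_mul hne))
  · simp only [MvPolynomial.coeff_mul]
    exact contMDiffOn_finsetSum fun b _ => (h2 b.1).mul (g2 b.2)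
  · simp [h3 x hx, g3 x hx]

theorem base_mul {c : M → ℝ} (hc : ContMDiffOn (𝓡 m) 𝓘(ℝ, ℝ) ∞ c U)
    (hf : IsFilteredFunction m U w f) : IsFilteredFunction m U w (fun x X => c x * f x X) :=
  ((base hc 0).mul hf).mono subset_rfl (zero_add w).le

theorem sub (hf : IsFilteredFunction m U w f) (hg : IsFilteredFunction m U w g) :
    IsFilteredFunction m U w (fun x X => f x X - g x X) :=
  (hf.add (base_mul (contMDiffOn_const (c := (-1 : ℝ))) hg)).congr fun x _ X => by ring

theorem sum {ι : Type*} {s : Finset ι} {f : ι → M → GradedModel d → ℝ}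
    (hf : ∀ b ∈ s, IsFilteredFunction m U w (f b)) :
    IsFilteredFunction m U w (fun x X => ∑ b ∈ s, f b x X) := by
  classical
  induction s using Finset.induction_on with
  | empty => simpa using base (d := d) (contMDiffOn_const (c := (0 : ℝ))) w
  | insert b s hb ih =>
    simp only [Finset.sum_insert hb]
    exact (hf b (by simp)).add (ih fun c hc => hf c (by simp [hc]))

theorem prod {ι : Type*} {s : Finset ι} {wt : ι → ℕ} {f : ι → M → GradedModel d → ℝ}
    (hf : ∀ b ∈ s, IsFilteredFunction m U (wt b) (f b)) :
    IsFilteredFunction m U (∑ b ∈ s, wt b) (fun x X => ∏ b ∈ s, f b x X) := by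
  classical
  induction s using Finset.induction_on with
  | empty => simpa using base (d := d) (contMDiffOn_const (c := (1 : ℝ))) 0
  | insert b s hb ih =>
    simp only [Finset.prod_insert hb, Finset.sum_insert hb]
    exact (hf b (by simp)).mul (ih fun c hc => hf c (by simp [hc]))

theorem pow (hf : IsFilteredFunction m U w f) (n : ℕ) :
    IsFilteredFunction m U (n * w) (fun x X => f x X ^ n) := by
  simpa using prod (s := Finset.range n) (wt := fun _ => w) fun _ _ => hf

/-- All weights are positive, so only finitely many exponents have weight at most `w`. One finite
index set therefore serves all base points, although the support of the polynomial varies with `x`.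
-/
theorem exists_expansion (hf : IsFilteredFunction m U w f) :
    ∃ (S : Finset (CoordIndex d →₀ ℕ)) (c : (CoordIndex d →₀ ℕ) → M → ℝ),
      (∀ n ∈ S, Finsupp.weight (coordWeight d) n ≤ w) ∧
      (∀ n, ContMDiffOn (𝓡 m) 𝓘(ℝ, ℝ) ∞ (c n) U) ∧
      ∀ x ∈ U, ∀ X, f x X = ∑ n ∈ S, c n x * ∏ j : CoordIndex d, X j.1 j.2 ^ n j := by
  classical
  obtain ⟨p, h1, h2, h3⟩ := hf
  have hfin := Finsupp.finite_of_nat_weight_le (coordWeight d) (fun j => Nat.succ_ne_zero _) w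
  refine ⟨hfin.toFinset, fun n x => (p x).coeff n, fun n hn => by simpa using hn, h2,
    fun x hx X => ?_⟩
  rw [h3 x hx, MvPolynomial.eval_eq']
  refine Finset.sum_subset (fun n hn => ?_) fun n _ hn => ?_
  · rw [Set.Finite.mem_toFinset]
    exact weightedTotalDegree_le_iff.1 (h1 x hx) n (MvPolynomial.mem_support_iff.1 hn)
  · rw [MvPolynomial.notMem_support_iff.1 hn, zero_mul]

/-- Substituting a function of degree at most the weight of each variable turns a monomial into a
function of degree at most the weight of that monomial. -/
theorem comp {f : M → GradedModel d' → ℝ} (hf : IsFilteredFunction m U w f)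
    {T : M → GradedModel d → GradedModel d'} (hT : IsFilteredFamily m U T) :
    IsFilteredFunction m U w (fun x X => f x (T x X)) := by
  obtain ⟨S, c, h1, h2, h3⟩ := hf.exists_expansion
  refine IsFilteredFunction.congr (f := fun x X => ∑ n ∈ S, c n x *
    ∏ j : CoordIndex d', T x X j.1 j.2 ^ n j) (sum fun n hn => base_mul (h2 n) ?_)
    fun x hx X => h3 x hx _
  refine (prod fun j _ => IsFilteredFunction.pow (hT j.1 j.2) (n j)).mono subset_rfl ?_
  refine le_trans (le_of_eq ?_) (h1 n hn)
  rw [Finsupp.weight_eq_sum]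
  rfl

theorem contMDiffOn_apply (hf : IsFilteredFunction m U w f) (X : GradedModel d) :
    ContMDiffOn (𝓡 m) 𝓘(ℝ, ℝ) ∞ (fun x => f x X) U := by
  obtain ⟨S, c, h1, h2, h3⟩ := hf.exists_expansion
  refine ContMDiffOn.congr ?_ fun x hx => h3 x hx X
  exact contMDiffOn_finsetSum fun n _ => (h2 n).mul contMDiffOn_const

theorem of_locally (h : ∀ x ∈ U, ∃ V, IsOpen V ∧ x ∈ V ∧ IsFilteredFunction m (V ∩ U) w f) :
    IsFilteredFunction m U w f := by
  classical
  choose! V hVo hxV p h1 h2 h3 using h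
  -- A real polynomial is determined by its values, so the local choices agree and the diagonal
  -- choice `p x x` has smooth coefficients.
  have key : ∀ x ∈ U, ∀ y ∈ V x ∩ U, p y y = p x y := by
    intro x hx y hy
    refine MvPolynomial.funext fun X => ?_
    have e1 := h3 y hy.2 y ⟨hxV y hy.2, hy.2⟩ (fun i a => X ⟨i, a⟩)
    have e2 := h3 x hx y hy (fun i a => X ⟨i, a⟩)
    exact e1.symm.trans e2
  refine ⟨fun x => p x x, fun x hx => h1 x hx x ⟨hxV x hx, hx⟩, fun n x hx => ?_,
    fun x hx => h3 x hx x ⟨hxV x hx, hx⟩⟩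
  have h := h2 x hx n x ⟨hxV x hx, hx⟩
  rw [inter_comm] at h
  refine ContMDiffWithinAt.congr_of_eventuallyEq
    ((contMDiffWithinAt_inter ((hVo x hx).mem_nhds (hxV x hx))).1 h) ?_ rfl
  filter_upwards [self_mem_nhdsWithin,
    mem_nhdsWithin_of_mem_nhds ((hVo x hx).mem_nhds (hxV x hx))] with y hy hy'
  rw [key x hx y ⟨hy', hy⟩]

end IsFilteredFunction

namespace IsFilteredFamily

variable {T : M → GradedModel d → GradedModel d'}

theorem mono (hT : IsFilteredFamily m U T) (hV : V ⊆ U) : IsFilteredFamily m V T :=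
  fun i a => IsFilteredFunction.mono (hT i a) hV le_rfl

theorem congr (hT : IsFilteredFamily m U T) {S : M → GradedModel d → GradedModel d'}
    (h : ∀ x ∈ U, ∀ X, S x X = T x X) : IsFilteredFamily m U S :=
  fun i a => IsFilteredFunction.congr (hT i a) fun x hx X => by rw [h x hx X]

theorem comp {p : ℕ} {d'' : Fin p → ℕ} {S : M → GradedModel d' → GradedModel d''}
    (hS : IsFilteredFamily m U S) (hT : IsFilteredFamily m U T) :
    IsFilteredFamily m U (fun x X => S x (T x X)) :=
  fun i a => IsFilteredFunction.comp (hS i a) hT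

theorem id : IsFilteredFamily m U (fun (_ : M) (X : GradedModel d) => X) :=
  fun i a => IsFilteredFunction.coord ⟨i, a⟩

theorem of_locally (h : ∀ x ∈ U, ∃ V, IsOpen V ∧ x ∈ V ∧ IsFilteredFamily m (V ∩ U) T) :
    IsFilteredFamily m U T := fun i a => IsFilteredFunction.of_locally fun x hx => by
  obtain ⟨V, h1, h2, h3⟩ := h x hx
  exact ⟨V, h1, h2, h3 i a⟩

end IsFilteredFamily

end FilteredFunctions

/-! ### Block triangular form of filtered maps -/

section DiagonalPart

variable {m : ℕ} {M : Type*} [TopologicalSpace M] [ChartedSpace (EuclideanSpace ℝ (Fin m)) M]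
  {k : ℕ} {d : Fin k → ℕ} {U : Set M} {x : M}

/-- One factor of weight at least `i + 1` already exhausts the available weight; the remaining
exponent has weight 0, and it vanishes because weights are positive. -/
theorem eq_of_weight_le {n : CoordIndex d →₀ ℕ} {i : Fin k}
    (hn : Finsupp.weight (coordWeight d) n ≤ i + 1) {j : CoordIndex d} (hj : n j ≠ 0)
    (hij : i ≤ j.1) : j.1 = i ∧ n = Finsupp.single j 1 := by
  classical
  have hle : Finsupp.single j 1 ≤ n := by
    rw [Finsupp.single_le_iff]
    exact Nat.one_le_iff_ne_zero.2 hj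
  obtain ⟨n', rfl⟩ := exists_add_of_le hle
  rw [map_add, Finsupp.weight_single, one_smul, coordWeight] at hn
  have hij' : (i : ℕ) ≤ j.1 := hij
  have h0 : Finsupp.weight (coordWeight d) n' = 0 := by omega
  refine ⟨Fin.ext (by omega), ?_⟩
  rw [add_eq_left]
  ext c
  by_contra hc
  have := Finsupp.le_weight (coordWeight d) (s := c) (Nat.succ_ne_zero _) n'
  simp only [Finsupp.coe_zero, Pi.zero_apply] at hc
  omega

theorem prod_pow_congr {n : CoordIndex d →₀ ℕ} {X Y : GradedModel d}
    (h : ∀ j, n j ≠ 0 → X j.1 = Y j.1) :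
    ∏ j : CoordIndex d, X j.1 j.2 ^ n j = ∏ j : CoordIndex d, Y j.1 j.2 ^ n j := by
  refine Finset.prod_congr rfl fun j _ => ?_
  by_cases hj : n j = 0
  · simp [hj]
  · rw [h j hj]

/-- Either the monomial is a single coordinate of weight `i + 1`, or it involves only smaller
weights and both sides vanish. Values at basis vectors and at 0 appear so that the sum over
monomials becomes `diagPart`. -/
theorem prod_pow_sub_prod_pow {n : CoordIndex d →₀ ℕ} {i : Fin k}
    (hn : Finsupp.weight (coordWeight d) n ≤ i + 1) {X Y : GradedModel d}
    (h : ∀ j < i, X j = Y j) :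
    ∏ j : CoordIndex d, X j.1 j.2 ^ n j - ∏ j : CoordIndex d, Y j.1 j.2 ^ n j =
      ∑ b, (X i b - Y i b) *
        (∏ j : CoordIndex d,
            (Pi.single i (Pi.single b 1) : GradedModel d) j.1 j.2 ^ n j -
          ∏ j : CoordIndex d, (0 : GradedModel d) j.1 j.2 ^ n j) := by
  classical
  by_cases hex : ∃ j, n j ≠ 0 ∧ i ≤ j.1
  · obtain ⟨⟨j, c⟩, hj, hij⟩ := hex
    obtain ⟨h1, rfl⟩ := eq_of_weight_le hn hj hij
    dsimp only at h1
    subst h1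
    have key : ∀ Z : GradedModel d,
        ∏ a : CoordIndex d, Z a.1 a.2 ^ (Finsupp.single (⟨j, c⟩ : CoordIndex d) 1) a = Z j c := by
      intro Z
      simp [Finsupp.single_apply, Finset.prod_ite_eq]
    simp only [key]
    simp [Pi.single_apply]
  · push Not at hex
    rw [prod_pow_congr fun j hj => h j.1 (hex j hj), sub_self, eq_comm]
    refine Finset.sum_eq_zero fun b _ => ?_
    rw [prod_pow_congr (Y := 0) fun j hj => Pi.single_eq_of_ne (hex j hj).ne _, sub_self, mul_zero]

/-- The linear part of the `i`-th component of a map `GradedModel d → GradedModel d`, with respect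
to the `i`-th variable. -/
noncomputable def diagPart (T : GradedModel d → GradedModel d) (i : Fin k) :
    (Fin (d i) → ℝ) →L[ℝ] (Fin (d i) → ℝ) :=
  ∑ b, (ContinuousLinearMap.proj (R := ℝ) (φ := fun _ : Fin (d i) => ℝ) b).smulRight
    (T (Pi.single i (Pi.single b 1)) i - T 0 i)

theorem diagPart_apply (T : GradedModel d → GradedModel d) (i : Fin k) (v : Fin (d i) → ℝ)
    (a : Fin (d i)) :
    diagPart T i v a = ∑ b, v b * (T (Pi.single i (Pi.single b 1)) i a - T 0 i a) := by
  simp [diagPart, Finset.sum_apply]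

theorem diagPart_eq_id {T : GradedModel d → GradedModel d} {i : Fin k}
    (h : ∀ X Y : GradedModel d, (∀ j < i, X j = Y j) → T X i - T Y i = X i - Y i) :
    diagPart T i = ContinuousLinearMap.id ℝ _ := by
  ext v a
  rw [diagPart_apply]
  have : ∀ b : Fin (d i), T (Pi.single i (Pi.single b 1)) i a - T 0 i a =
      (Pi.single b 1 : Fin (d i) → ℝ) a := by
    intro b
    have := congrFun (h (Pi.single i (Pi.single b 1)) 0 fun j hj => by
      rw [Pi.single_eq_of_ne hj.ne]; rfl) a
    simpa using this
  simp [this, Pi.single_apply]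

namespace IsFilteredFamily

variable {T S : M → GradedModel d → GradedModel d}

theorem sub_eq_diagPart (hT : IsFilteredFamily m U T) (hx : x ∈ U) {i : Fin k}
    {X Y : GradedModel d} (h : ∀ j < i, X j = Y j) :
    T x X i - T x Y i = diagPart (T x) i (X i - Y i) := by
  ext a
  obtain ⟨A, c, h1, -, h3⟩ := IsFilteredFunction.exists_expansion (hT i a)
  have h3 := h3 x hx
  simp only [diagPart_apply, Pi.sub_apply, h3, ← Finset.sum_sub_distrib, ← mul_sub,
    Finset.mul_sum]
  rw [Finset.sum_comm]
  refine Finset.sum_congr rfl fun n hn => ?_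
  rw [prod_pow_sub_prod_pow (h1 n hn) h, Finset.mul_sum]
  exact Finset.sum_congr rfl fun b _ => by ring

theorem apply_eq_apply (hT : IsFilteredFamily m U T) (hx : x ∈ U) {i : Fin k}
    {X Y : GradedModel d} (h : ∀ j ≤ i, X j = Y j) : T x X i = T x Y i := by
  have := hT.sub_eq_diagPart hx (i := i) fun j hj => h j hj.le
  rwa [h i le_rfl, sub_self, map_zero, sub_eq_zero] at this

/-- Compare the vector `v` placed in slot `i` with 0. Their images under `T x` still agree below
`i`, because lower components depend only on lower coordinates, so the triangular form applies again
to `S x`. -/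
theorem diagPart_comp (hS : IsFilteredFamily m U S) (hT : IsFilteredFamily m U T) (hx : x ∈ U)
    (i : Fin k) (v : Fin (d i) → ℝ) :
    diagPart (fun X => S x (T x X)) i v = diagPart (S x) i (diagPart (T x) i v) := by
  have h0 : ∀ j < i, (Pi.single i v : GradedModel d) j = (0 : GradedModel d) j := fun j hj => by
    rw [Pi.single_eq_of_ne hj.ne]; rfl
  have e1 := (hS.comp hT).sub_eq_diagPart hx h0
  have e2 := hT.sub_eq_diagPart hx h0
  have e3 := hS.sub_eq_diagPart hx (i := i) (X := T x (Pi.single i v)) (Y := T x 0)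
    fun j hj => hT.apply_eq_apply hx fun a ha => h0 a (ha.trans_lt hj)
  simp only [Pi.single_eq_same, Pi.zero_apply, sub_zero] at e1 e2
  rw [← e1, e3, e2]

theorem contMDiffOn_diagPart (hT : IsFilteredFamily m U T) (i : Fin k) :
    ContMDiffOn (𝓡 m) 𝓘(ℝ, (Fin (d i) → ℝ) →L[ℝ] (Fin (d i) → ℝ)) ∞
      (fun x => diagPart (T x) i) U := by
  unfold diagPart
  refine contMDiffOn_finsetSum fun b _ => ?_
  have h : ContMDiffOn (𝓡 m) 𝓘(ℝ, Fin (d i) → ℝ) ∞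
      (fun x => T x (Pi.single i (Pi.single b 1)) i - T x 0 i) U := by
    refine contMDiffOn_pi_space.2 fun a => ?_
    exact (IsFilteredFunction.contMDiffOn_apply (hT i a) _).sub
      (IsFilteredFunction.contMDiffOn_apply (hT i a) _)
  exact (ContinuousLinearMap.smulRightL ℝ (Fin (d i) → ℝ) (Fin (d i) → ℝ)
    (ContinuousLinearMap.proj b)).contDiff.contMDiff.comp_contMDiffOn h

end IsFilteredFamily

end DiagonalPart

/-! ### Inversion of unipotent filtered maps -/

section Inverse

variable {m : ℕ} {M : Type*} [TopologicalSpace M] [ChartedSpace (EuclideanSpace ℝ (Fin m)) M]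
  {k : ℕ} {d : Fin k → ℕ} {U : Set M}

/-- A map of the graded model is unipotent if its `i`-th component is the `i`-th coordinate plus a
function of the coordinates of smaller weight. -/
def IsUnipotent (T : GradedModel d → GradedModel d) : Prop :=
  ∀ (i : Fin k) (X Y : GradedModel d), (∀ j < i, X j = Y j) → T X i - T Y i = X i - Y i

theorem IsUnipotent.injective {T : GradedModel d → GradedModel d} (hT : IsUnipotent T) :
    Function.Injective T := by
  intro X Y h
  funext i
  induction i using WellFoundedLT.induction with
  | _ i ih =>
    have := hT i X Y ih
    rw [h, sub_self, eq_comm, sub_eq_zero] at this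
    exact this

/-- Successive approximations of the inverse of a unipotent map. -/
def unipotentInvAux (T : GradedModel d → GradedModel d) : ℕ → GradedModel d → GradedModel d
  | 0, _ => 0
  | n + 1, Y => unipotentInvAux T n Y + (Y - T (unipotentInvAux T n Y))

/-- Each iteration makes one more weight exact: the correction vanishes in the components already
solved, so by unipotence it shifts the next component of `T` by precisely the remaining error. Hence
`k` iterations suffice. -/
theorem IsUnipotent.apply_unipotentInvAux {T : GradedModel d → GradedModel d}
    (hT : IsUnipotent T) (Y : GradedModel d) (n : ℕ) (i : Fin k) (hi : (i : ℕ) < n) :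
    T (unipotentInvAux T n Y) i = Y i := by
  induction n generalizing i with
  | zero => omega
  | succ n ih =>
    have := hT i (unipotentInvAux T (n + 1) Y) (unipotentInvAux T n Y) fun j hj => by
      have hj' : (j : ℕ) < i := hj
      simp [unipotentInvAux, ih j (by omega)]
    simp only [unipotentInvAux, Pi.add_apply, Pi.sub_apply, add_sub_cancel_left] at this ⊢
    simpa using this

/-- The inverse of a unipotent map. -/
def unipotentInv (T : GradedModel d → GradedModel d) : GradedModel d → GradedModel d :=
  unipotentInvAux T k

theorem IsUnipotent.rightInverse {T : GradedModel d → GradedModel d} (hT : IsUnipotent T) :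
    Function.RightInverse (unipotentInv T) T :=
  fun Y => funext fun i => hT.apply_unipotentInvAux Y k i i.2

theorem IsUnipotent.leftInverse {T : GradedModel d → GradedModel d} (hT : IsUnipotent T) :
    Function.LeftInverse (unipotentInv T) T :=
  fun X => hT.injective (hT.rightInverse (T X))

theorem IsFilteredFamily.unipotentInv {T : M → GradedModel d → GradedModel d}
    (hT : IsFilteredFamily m U T) : IsFilteredFamily m U (fun x => unipotentInv (T x)) := by
  suffices ∀ n, IsFilteredFamily m U (fun x => unipotentInvAux (T x) n) from this k
  intro n
  induction n with
  | zero => exact fun i a => IsFilteredFunction.base contMDiffOn_const _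
  | succ n ih =>
    exact fun i a => IsFilteredFunction.add (ih i a)
      (IsFilteredFunction.sub (IsFilteredFunction.coord ⟨i, a⟩) (hT.comp ih i a))

end Inverse

/-! ### Fibre coordinates in a trivialization -/

section FiberCoordinates

variable {B F : Type*} {E : B → Type*} [TopologicalSpace B] [TopologicalSpace F]
  [TopologicalSpace (TotalSpace F E)]

theorem Bundle.Trivialization.exists_symm_eq_mk (e : Trivialization F (π F E)) {x : B}
    (hx : x ∈ e.baseSet) (X : F) :
    ∃ p : E x, e.toOpenPartialHomeomorph.symm (x, X) = ⟨x, p⟩ ∧ (e ⟨x, p⟩).2 = X := by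
  have h1 := e.proj_symm_apply' (x := X) hx
  have h2 := e.apply_symm_apply' (x := X) hx
  generalize e.toOpenPartialHomeomorph.symm (x, X) = q at h1 h2
  obtain ⟨y, p⟩ := q
  obtain rfl : y = x := h1
  exact ⟨p, rfl, by rw [h2]⟩

theorem Bundle.Trivialization.symm_mk_apply_snd (e : Trivialization F (π F E)) {x : B}
    (hx : x ∈ e.baseSet) (p : E x) :
    e.toOpenPartialHomeomorph.symm (x, (e ⟨x, p⟩).2) = ⟨x, p⟩ :=
  e.symm_apply_mk_proj (x := (⟨x, p⟩ : TotalSpace F E)) (e.mem_source.2 hx)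

theorem Bundle.Trivialization.bijective_snd (e : Trivialization F (π F E)) {x : B}
    (hx : x ∈ e.baseSet) : Function.Bijective fun p : E x => (e ⟨x, p⟩).2 := by
  refine ⟨fun p q h => ?_, fun X => ?_⟩
  · dsimp only at h
    have hp := e.symm_mk_apply_snd hx p
    rw [h, e.symm_mk_apply_snd hx q] at hp
    simpa using hp.symm
  · obtain ⟨p, -, hp⟩ := e.exists_symm_eq_mk hx X
    exact ⟨p, hp⟩

end FiberCoordinates

/-! ### Local recognition and composition of filtered morphisms -/

section FilteredMorphisms

variable {m : ℕ} {M : Type*} [TopologicalSpace M] [ChartedSpace (EuclideanSpace ℝ (Fin m)) M]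
  {k l r : ℕ} {d : Fin k → ℕ} {d' : Fin l → ℕ} {d'' : Fin r → ℕ}
  {E : M → Type*} {E' : M → Type*} {E'' : M → Type*}
  [TopologicalSpace (TotalSpace (GradedModel d) E)] [∀ x, TopologicalSpace (E x)]
  [FiberBundle (GradedModel d) E]
  [TopologicalSpace (TotalSpace (GradedModel d') E')] [∀ x, TopologicalSpace (E' x)]
  [FiberBundle (GradedModel d') E']
  [TopologicalSpace (TotalSpace (GradedModel d'') E'')] [∀ x, TopologicalSpace (E'' x)]
  [FiberBundle (GradedModel d'') E'']

/-- A filtered morphism can be recognized by its coordinate expression, near each point, in one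
pair of trivializations. -/
theorem isFilteredMorphism_of_locally [FilteredBundle m d E] [FilteredBundle m d' E']
    {Φ : ∀ x, E x → E' x}
    (h : ∀ x₀ : M, ∃ (e : Trivialization (GradedModel d) (π (GradedModel d) E))
      (e' : Trivialization (GradedModel d') (π (GradedModel d') E'))
      (U : Set M) (T : M → GradedModel d → GradedModel d'),
      MemTrivializationAtlas e ∧ MemTrivializationAtlas e' ∧ IsOpen U ∧ x₀ ∈ U ∧
      U ⊆ e.baseSet ∩ e'.baseSet ∧ IsFilteredFamily m U T ∧
      ∀ x ∈ U, ∀ p : E x, T x (e ⟨x, p⟩).2 = (e' ⟨x, Φ x p⟩).2) :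
    IsFilteredMorphism m d d' Φ := by
  intro e e' _ _
  refine IsFilteredFamily.of_locally fun x₀ hx₀ => ?_
  obtain ⟨f, f', U, T, hf, hf', hU, hxU, hUf, hT, hrep⟩ := h x₀
  refine ⟨U, hU, hxU, ?_⟩
  have h1 : IsFilteredFamily m (U ∩ (e.baseSet ∩ e'.baseSet)) fun x X => e.coordChange f x X :=
    (FilteredBundle.filtered_coordChange e f).mono fun x hx => ⟨hx.2.1, (hUf hx.1).1⟩
  have h2 : IsFilteredFamily m (U ∩ (e.baseSet ∩ e'.baseSet)) fun x X => f'.coordChange e' x X :=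
    (FilteredBundle.filtered_coordChange f' e').mono fun x hx => ⟨(hUf hx.1).2, hx.2.2⟩
  -- The expression in arbitrary trivializations is `T` between the changes of coordinates from `e`
  -- to `f` and from `f'` to `e'`.
  refine (h2.comp ((hT.mono inter_subset_left).comp h1)).congr fun x hx X => ?_
  obtain ⟨p, hp, rfl⟩ := e.exists_symm_eq_mk hx.2.1 X
  have c1 : e.coordChange f x (e ⟨x, p⟩).2 = (f ⟨x, p⟩).2 :=
    e.coordChange_apply_snd f (p := (⟨x, p⟩ : TotalSpace (GradedModel d) E)) hx.2.1
  have c2 : f'.coordChange e' x (f' ⟨x, Φ x p⟩).2 = (e' ⟨x, Φ x p⟩).2 :=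
    f'.coordChange_apply_snd e' (p := (⟨x, Φ x p⟩ : TotalSpace (GradedModel d') E'))
      (hUf hx.1).2
  dsimp only
  rw [hp, c1, hrep x hx.1, c2]

theorem IsFilteredMorphism.exists_rep {Φ : ∀ x, E x → E' x} (hΦ : IsFilteredMorphism m d d' Φ)
    (e : Trivialization (GradedModel d) (π (GradedModel d) E))
    (e' : Trivialization (GradedModel d') (π (GradedModel d') E'))
    [MemTrivializationAtlas e] [MemTrivializationAtlas e'] :
    ∃ T, IsFilteredFamily m (e.baseSet ∩ e'.baseSet) T ∧
      ∀ x ∈ e.baseSet, ∀ p : E x, T x (e ⟨x, p⟩).2 = (e' ⟨x, Φ x p⟩).2 := by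
  refine ⟨_, hΦ e e', fun x hx p => ?_⟩
  dsimp only
  rw [e.symm_mk_apply_snd hx p]

theorem IsFilteredMorphism.comp [FilteredBundle m d E] [FilteredBundle m d'' E'']
    {Ψ : ∀ x, E' x → E'' x} {Φ : ∀ x, E x → E' x} (hΨ : IsFilteredMorphism m d' d'' Ψ)
    (hΦ : IsFilteredMorphism m d d' Φ) :
    IsFilteredMorphism m d d'' (fun x p => Ψ x (Φ x p)) := by
  refine isFilteredMorphism_of_locally fun x₀ => ?_
  let e := trivializationAt (GradedModel d) E x₀
  let e' := trivializationAt (GradedModel d') E' x₀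
  let e'' := trivializationAt (GradedModel d'') E'' x₀
  obtain ⟨S, hS, hSrep⟩ := hΨ.exists_rep e' e''
  obtain ⟨T, hT, hTrep⟩ := hΦ.exists_rep e e'
  refine ⟨e, e'', e.baseSet ∩ e'.baseSet ∩ e''.baseSet, fun x X => S x (T x X), inferInstance,
    inferInstance, (e.open_baseSet.inter e'.open_baseSet).inter e''.open_baseSet,
    ⟨⟨FiberBundle.mem_baseSet_trivializationAt' x₀, FiberBundle.mem_baseSet_trivializationAt' x₀⟩,
      FiberBundle.mem_baseSet_trivializationAt' x₀⟩,
    fun x hx => ⟨hx.1.1, hx.2⟩,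
    (hS.mono fun x hx => ⟨hx.1.2, hx.2⟩).comp (hT.mono inter_subset_left), fun x hx p => ?_⟩
  dsimp only
  rw [hTrep x hx.1.1, hSrep x hx.1.2]

/-- The inverse of an isomorphism of filtered bundles. -/
def FilteredIso.symm (Φ : FilteredIso m d d' E E') : FilteredIso m d' d E' E where
  toEquiv x := (Φ.toEquiv x).symm
  filtered_toEquiv := Φ.filtered_symm
  filtered_symm := Φ.filtered_toEquiv

/-- The composition of isomorphisms of filtered bundles. -/
def FilteredIso.trans [FilteredBundle m d E] [FilteredBundle m d'' E'']
    (Φ : FilteredIso m d d' E E') (Ψ : FilteredIso m d' d'' E' E'') :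
    FilteredIso m d d'' E E'' where
  toEquiv x := (Φ.toEquiv x).trans (Ψ.toEquiv x)
  filtered_toEquiv := Ψ.filtered_toEquiv.comp Φ.filtered_toEquiv
  filtered_symm := Φ.filtered_symm.comp Ψ.filtered_symm

end FilteredMorphisms

/-! ### Translations as non-graded filtered automorphisms -/

section Translations

variable {m : ℕ} {M : Type*} [TopologicalSpace M] [ChartedSpace (EuclideanSpace ℝ (Fin m)) M]
  {k : ℕ} {d : Fin k → ℕ} (V : ∀ i : Fin k, SmoothVectorBundle m M (d i))

/-- The section of the Whitney sum equal to `χ x • c` in the trivialization at `x₀`. -/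
noncomputable def WhitneySum.bumpSection (χ : M → ℝ) (x₀ : M) (c : GradedModel d) (x : M) :
    WhitneySum V x :=
  fun i => χ x • (trivializationAt (Fin (d i) → ℝ) (V i).Fiber x₀).symm x (c i)

variable {V} {χ : M → ℝ} {x₀ : M} {c : GradedModel d}

theorem WhitneySum.trivializationAt_add_bumpSection {x : M}
    (hx : x ∈ (trivializationAt (GradedModel d) (WhitneySum V) x₀).baseSet)
    (v : WhitneySum V x) :
    (trivializationAt (GradedModel d) (WhitneySum V) x₀ ⟨x, v + bumpSection V χ x₀ c x⟩).2 =
      (trivializationAt (GradedModel d) (WhitneySum V) x₀ ⟨x, v⟩).2 + χ x • c := by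
  funext i
  have hi : x ∈ (trivializationAt (Fin (d i) → ℝ) (V i).Fiber x₀).baseSet := mem_iInter.1 hx i
  have hlin := (trivializationAt (Fin (d i) → ℝ) (V i).Fiber x₀).linear ℝ hi
  have h1 := (hlin.map_add (v i) (bumpSection V χ x₀ c x i)).trans
    (congrArg _ (hlin.map_smul (χ x) _))
  rw [Trivialization.apply_mk_symm _ hi] at h1
  exact h1

/-- In the trivialization at `x₀` the map adds a term of degree 0 with smooth coefficients; away
from the closed support of `χ` it is the identity. -/
theorem WhitneySum.isFilteredMorphism_add_bumpSection (hχ : ContMDiff (𝓡 m) 𝓘(ℝ, ℝ) ∞ χ)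
    (hsupp : tsupport χ ⊆ (trivializationAt (GradedModel d) (WhitneySum V) x₀).baseSet) :
    IsFilteredMorphism m d d (fun x (v : WhitneySum V x) => v + bumpSection V χ x₀ c x) := by
  refine isFilteredMorphism_of_locally fun x₁ => ?_
  by_cases hx₁ : x₁ ∈ tsupport χ
  · let e := trivializationAt (GradedModel d) (WhitneySum V) x₀
    refine ⟨e, e, e.baseSet, fun x X => X + χ x • c, inferInstance, inferInstance, e.open_baseSet,
      hsupp hx₁, fun x hx => ⟨hx, hx⟩, fun i a => ?_, fun x hx v =>
        (trivializationAt_add_bumpSection hx v).symm⟩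
    exact (IsFilteredFunction.coord ⟨i, a⟩).add
      (IsFilteredFunction.base (hχ.contMDiffOn.mul contMDiffOn_const) _)
  · let e := trivializationAt (GradedModel d) (WhitneySum V) x₁
    refine ⟨e, e, e.baseSet ∩ (tsupport χ)ᶜ, fun x X => X, inferInstance, inferInstance,
      e.open_baseSet.inter (isClosed_tsupport χ).isOpen_compl,
      ⟨FiberBundle.mem_baseSet_trivializationAt' x₁, hx₁⟩, fun x hx => ⟨hx.1, hx.1⟩,
      IsFilteredFamily.id, fun x hx v => ?_⟩
    have h0 : bumpSection V χ x₀ c x = 0 := by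
      funext i
      simp only [bumpSection, image_eq_zero_of_notMem_tsupport hx.2, zero_smul]
      rfl
    rw [h0, add_zero]

/-- Translation by a bump section, as an automorphism of the Whitney sum as a filtered bundle. -/
noncomputable def WhitneySum.translation (hχ : ContMDiff (𝓡 m) 𝓘(ℝ, ℝ) ∞ χ)
    (hsupp : tsupport χ ⊆ (trivializationAt (GradedModel d) (WhitneySum V) x₀).baseSet)
    (c : GradedModel d) : FilteredIso m d d (WhitneySum V) (WhitneySum V) where
  toEquiv x := Equiv.addRight (bumpSection V χ x₀ c x)
  filtered_toEquiv := isFilteredMorphism_add_bumpSection hχ hsupp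
  filtered_symm := by
    have h : ∀ x, -bumpSection V χ x₀ c x = bumpSection V (fun x => -χ x) x₀ c x := fun x => by
      funext i
      exact (neg_smul _ _).symm
    have hs : tsupport (fun x => -χ x) ⊆
        (trivializationAt (GradedModel d) (WhitneySum V) x₀).baseSet := by
      rw [tsupport, Function.support_fun_neg]
      exact hsupp
    have := isFilteredMorphism_add_bumpSection (V := V) (c := c) hχ.neg hs
    simpa only [Equiv.addRight_symm, Equiv.coe_addRight, h] using this

theorem WhitneySum.exists_filteredIso_not_isGraded [T2Space M] [IsManifold (𝓡 m) ∞ M]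
    (x₀ : M) (hd : ∃ i, 0 < d i) :
    ∃ ψ : FilteredIso m d d (WhitneySum V) (WhitneySum V),
      ¬ WhitneySum.IsGraded (V := V) (fun x => ψ.toEquiv x) := by
  obtain ⟨i, hi⟩ := hd
  let e := trivializationAt (GradedModel d) (WhitneySum V) x₀
  have hx₀ : x₀ ∈ e.baseSet := FiberBundle.mem_baseSet_trivializationAt' x₀
  obtain ⟨χ, -, hχ⟩ := (SmoothBumpFunction.nhds_basis_tsupport (I := 𝓡 m) x₀).mem_iff.1
    (e.open_baseSet.mem_nhds hx₀)
  let c : GradedModel d := fun _ _ => 1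
  refine ⟨translation χ.contMDiff hχ c, fun h => ?_⟩
  have h1 : bumpSection V χ x₀ c x₀ = 0 := by
    -- At `t = 0` the homogeneity structure is the zero map, because all weights are positive;
    -- commuting with it forces the zero vector to be fixed.
    have h2 := h x₀ 0 0
    have h3 : ∀ v : WhitneySum V x₀, homogeneity 0 v = 0 := fun v => by
      funext j
      simp only [homogeneity, ne_eq, Nat.add_eq_zero_iff, one_ne_zero, and_false,
        not_false_eq_true, zero_pow, zero_smul]
      rfl
    rw [h3, h3] at h2
    simpa [translation] using h2
  have h4 := trivializationAt_add_bumpSection (V := V) (χ := χ) (c := c) hx₀ 0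
  rw [h1, add_zero, χ.eq_one, one_smul, left_eq_add] at h4
  exact one_ne_zero (congrFun (congrFun h4 i) ⟨0, hi⟩)

end Translations

/-! ### The associated graded bundle and the averaged splitting -/

section AssociatedGraded

variable (m : ℕ) {M : Type*} [TopologicalSpace M] [ChartedSpace (EuclideanSpace ℝ (Fin m)) M]
  {k : ℕ} (d : Fin k → ℕ) (E : M → Type*)
  [TopologicalSpace (TotalSpace (GradedModel d) E)] [∀ x, TopologicalSpace (E x)]
  [FiberBundle (GradedModel d) E]

/-- The base set of the preferred trivialization at a point. -/
abbrev baseSetAt (α : M) : Set M := (trivializationAt (GradedModel d) E α).baseSet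

/-- The change of fibre coordinates between the preferred trivializations at two points. -/
noncomputable abbrev transition (α β x : M) : GradedModel d → GradedModel d :=
  (trivializationAt (GradedModel d) E α).coordChange (trivializationAt (GradedModel d) E β) x

variable [FilteredBundle m d E]

theorem isFilteredFamily_transition (α β : M) :
    IsFilteredFamily m (baseSetAt d E α ∩ baseSetAt d E β) (transition d E α β) :=
  FilteredBundle.filtered_coordChange _ _

include m in
theorem diagPart_transition_comp {α β γ x : M} (hα : x ∈ baseSetAt d E α)
    (hβ : x ∈ baseSetAt d E β) (hγ : x ∈ baseSetAt d E γ) (i : Fin k) (v : Fin (d i) → ℝ) :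
    diagPart (transition d E β γ x) i (diagPart (transition d E α β x) i v) =
      diagPart (transition d E α γ x) i v := by
  have h1 := (isFilteredFamily_transition m d E α β).mono
    (V := baseSetAt d E α ∩ baseSetAt d E β ∩ baseSetAt d E γ) fun x hx => hx.1
  have h2 := (isFilteredFamily_transition m d E β γ).mono
    (V := baseSetAt d E α ∩ baseSetAt d E β ∩ baseSetAt d E γ) fun x hx => ⟨hx.1.2, hx.2⟩
  rw [← h2.diagPart_comp h1 ⟨⟨hα, hβ⟩, hγ⟩]
  congr 2
  funext X
  exact Trivialization.coordChange_coordChange _ _ _ hα hβ X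

omit [FilteredBundle m d E] in
theorem transition_self {α x : M} (hα : x ∈ baseSetAt d E α) (X : GradedModel d) :
    transition d E α α x X = X :=
  Trivialization.coordChange_same_apply _ hα X

omit [FilteredBundle m d E] in
theorem diagPart_transition_self {α x : M} (hα : x ∈ baseSetAt d E α) (i : Fin k) :
    diagPart (transition d E α α x) i = ContinuousLinearMap.id ℝ _ :=
  diagPart_eq_id fun X Y _ => by rw [transition_self d E hα, transition_self d E hα]

/-- The cocycle of the `i`-th graded piece of a filtered bundle. -/
noncomputable def gradedCore (i : Fin k) : VectorBundleCore ℝ M (Fin (d i) → ℝ) M where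
  baseSet := baseSetAt d E
  isOpen_baseSet α := (trivializationAt (GradedModel d) E α).open_baseSet
  indexAt x := x
  mem_baseSet_at x := FiberBundle.mem_baseSet_trivializationAt' x
  coordChange α β x := diagPart (transition d E α β x) i
  coordChange_self α x hx v := by rw [diagPart_transition_self d E hx]; rfl
  continuousOn_coordChange α β :=
    ((isFilteredFamily_transition m d E α β).contMDiffOn_diagPart i).continuousOn
  coordChange_comp α β γ x hx v := diagPart_transition_comp m d E hx.1.1 hx.1.2 hx.2 i v

instance (i : Fin k) : (gradedCore m d E i).IsContMDiff (𝓡 m) ∞ where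
  contMDiffOn_coordChange α β := (isFilteredFamily_transition m d E α β).contMDiffOn_diagPart i

/-- The `i`-th graded piece of a filtered bundle. -/
noncomputable def gradedPiece (i : Fin k) : SmoothVectorBundle m M (d i) where
  Fiber := (gradedCore m d E i).Fiber

variable {m d E} (ρ : SmoothPartitionOfUnity M (𝓡 m) M)

/-- The map from a filtered bundle to its associated graded bundle obtained by gluing the local
splittings given by the trivializations. -/
noncomputable def splitting (x : M) (p : E x) : WhitneySum (gradedPiece m d E) x :=
  -- The fibre of the core over `x` is a model space read in the chart of index `indexAt x = x`, so
  -- coordinates in chart `α` are carried there by the diagonal part of the transition from `α` to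
  -- `x`.
  fun i => (∑ α ∈ ρ.finsupport x, ρ α x • diagPart (transition d E α x x) i
    ((trivializationAt (GradedModel d) E α ⟨x, p⟩).2 i) : Fin (d i) → ℝ)

variable (d E) in
omit [FilteredBundle m d E] in
/-- The coordinate expression of the splitting. -/
noncomputable def splittingRep (β x : M) (X : GradedModel d) : GradedModel d :=
  fun i => ∑ α ∈ ρ.finsupport x, ρ α x • diagPart (transition d E α β x) i
    (transition d E β α x X i)

variable {ρ} (hρ : ρ.IsSubordinate (baseSetAt d E))
include hρ

omit [FilteredBundle m d E] in
theorem mem_baseSetAt_of_mem_finsupport {α x : M} (hα : α ∈ ρ.finsupport x) :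
    x ∈ baseSetAt d E α :=
  hρ α (subset_tsupport _ ((ρ.mem_finsupport x).1 hα))

/-- By the cocycle identity the passage from `α` to `x` to `β` equals that from `α` to `β`. This
removes the chart centred at the moving point `x`, on which nothing depends smoothly. -/
theorem trivializationAt_splitting {β x : M} (hx : x ∈ baseSetAt d E β) (p : E x) :
    (trivializationAt (GradedModel d) (WhitneySum (gradedPiece m d E)) β ⟨x, splitting ρ x p⟩).2 =
      splittingRep d E ρ β x (trivializationAt (GradedModel d) E β ⟨x, p⟩).2 := by
  funext i
  change diagPart (transition d E x β x) i (∑ α ∈ ρ.finsupport x, _) = _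
  rw [map_sum]
  refine Finset.sum_congr rfl fun α hα => ?_
  have hxα := mem_baseSetAt_of_mem_finsupport hρ hα
  rw [map_smul, diagPart_transition_comp m d E hxα
    (FiberBundle.mem_baseSet_trivializationAt' x) hx]
  have : transition d E β α x (trivializationAt (GradedModel d) E β ⟨x, p⟩).2 =
      (trivializationAt (GradedModel d) E α ⟨x, p⟩).2 :=
    Trivialization.coordChange_apply_snd _ _ (p := (⟨x, p⟩ : TotalSpace (GradedModel d) E)) hx
  rw [this]

/-- In every summand the diagonal parts of the transitions from `β` to `α` and back cancel, leaving
`ρ α x • (X i - Y i)`; the weights sum to one. -/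
theorem isUnipotent_splittingRep {β x : M} (hx : x ∈ baseSetAt d E β) :
    IsUnipotent (splittingRep d E ρ β x) := by
  intro i X Y h
  simp only [splittingRep, ← Finset.sum_sub_distrib]
  have : ∀ α ∈ ρ.finsupport x, ρ α x • diagPart (transition d E α β x) i
      (transition d E β α x X i) - ρ α x • diagPart (transition d E α β x) i
      (transition d E β α x Y i) = ρ α x • (X i - Y i) := by
    intro α hα
    have hxα := mem_baseSetAt_of_mem_finsupport hρ hα
    rw [← smul_sub, ← map_sub,
      (isFilteredFamily_transition m d E β α).sub_eq_diagPart ⟨hx, hxα⟩ h,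
      diagPart_transition_comp m d E hx hxα hx, diagPart_transition_self d E hx]
    rfl
  rw [Finset.sum_congr rfl this, ← Finset.sum_smul, ρ.sum_finsupport x (mem_univ x), one_smul]

theorem isFilteredFamily_splittingRep (β : M) :
    IsFilteredFamily m (baseSetAt d E β) (splittingRep d E ρ β) := by
  refine IsFilteredFamily.of_locally fun x₀ hx₀ => ?_
  -- Local finiteness: near `x₀` the sum over the varying set `ρ.finsupport x` becomes a sum over
  -- the fixed finite set `ρ.fintsupport x₀`, whose charts all contain a neighbourhood of `x₀`.
  obtain ⟨W, hWsub, hW, hxW⟩ := eventually_nhds_iff.1 (ρ.eventually_finsupport_subset x₀)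
  refine ⟨W ∩ ⋂ α ∈ ρ.fintsupport x₀, baseSetAt d E α,
    hW.inter (isOpen_biInter_finset fun α _ => (trivializationAt _ E α).open_baseSet),
    ⟨hxW, mem_iInter₂.2 fun α hα => hρ α ((ρ.mem_fintsupport_iff x₀ α).1 hα)⟩, fun i a => ?_⟩
  refine IsFilteredFunction.congr (f := fun x X => ∑ α ∈ ρ.fintsupport x₀, ρ α x *
    ∑ b, (transition d E α β x (Pi.single i (Pi.single b 1)) i a - transition d E α β x 0 i a) *
      transition d E β α x X i b) (IsFilteredFunction.sum fun α hα => ?_) fun x hx X => ?_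
  · have hsub : W ∩ (⋂ α ∈ ρ.fintsupport x₀, baseSetAt d E α) ∩ baseSetAt d E β ⊆
        baseSetAt d E α ∩ baseSetAt d E β := fun x hx => ⟨mem_iInter₂.1 hx.1.2 α hα, hx.2⟩
    have h1 := (isFilteredFamily_transition m d E α β).mono hsub
    have h2 := (isFilteredFamily_transition m d E β α).mono fun x hx => (hsub hx).symm
    exact (IsFilteredFunction.sum fun b _ => (IsFilteredFunction.mono (h2 i b) subset_rfl
      le_rfl).base_mul ((IsFilteredFunction.contMDiffOn_apply (h1 i a) _).sub
        (IsFilteredFunction.contMDiffOn_apply (h1 i a) _))).base_mul (ρ α).contMDiff.contMDiffOn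
  · rw [splittingRep, Finset.sum_apply, ← Finset.sum_subset (hWsub x hx.1.1)]
    · refine Finset.sum_congr rfl fun α _ => ?_
      rw [Pi.smul_apply, smul_eq_mul, diagPart_apply]
      exact congrArg _ (Finset.sum_congr rfl fun b _ => mul_comm _ _)
    · intro α _ hα
      rw [ρ.mem_finsupport, Function.notMem_support] at hα
      rw [hα, zero_mul]

theorem bijective_splitting (x : M) :
    Function.Bijective (splitting ρ x : E x → WhitneySum (gradedPiece m d E) x) := by
  have hx : x ∈ baseSetAt d E x := FiberBundle.mem_baseSet_trivializationAt' x
  have hU := isUnipotent_splittingRep hρ hx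
  have h1 : Function.Bijective (splittingRep d E ρ x x) :=
    ⟨hU.injective, hU.rightInverse.surjective⟩
  have h2 := h1.comp ((trivializationAt (GradedModel d) E x).bijective_snd hx)
  have h3 := (trivializationAt (GradedModel d) (WhitneySum (gradedPiece m d E)) x).bijective_snd
    (FiberBundle.mem_baseSet_trivializationAt' x)
  refine (Function.Bijective.of_comp_iff' h3 _).1 ?_
  convert h2 using 1
  funext p
  exact trivializationAt_splitting hρ hx p

/-- The isomorphism of a filtered bundle with its associated graded bundle defined by a partition
of unity. -/
noncomputable def splittingIso : FilteredIso m d d E (WhitneySum (gradedPiece m d E)) where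
  toEquiv x := Equiv.ofBijective _ (bijective_splitting hρ x)
  filtered_toEquiv := isFilteredMorphism_of_locally fun β => by
    have hβ : β ∈ baseSetAt d E β := FiberBundle.mem_baseSet_trivializationAt' β
    exact ⟨trivializationAt (GradedModel d) E β, trivializationAt (GradedModel d) _ β,
      baseSetAt d E β, splittingRep d E ρ β, inferInstance, inferInstance,
      (trivializationAt (GradedModel d) E β).open_baseSet, hβ,
      fun x hx => ⟨hx, mem_iInter.2 fun _ => hx⟩, isFilteredFamily_splittingRep hρ β,
      fun x hx p => (trivializationAt_splitting hρ hx p).symm⟩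
  filtered_symm := isFilteredMorphism_of_locally fun β => by
    have hβ : β ∈ baseSetAt d E β := FiberBundle.mem_baseSet_trivializationAt' β
    refine ⟨trivializationAt (GradedModel d) _ β, trivializationAt (GradedModel d) E β,
      baseSetAt d E β, fun x => unipotentInv (splittingRep d E ρ β x), inferInstance,
      inferInstance, (trivializationAt (GradedModel d) E β).open_baseSet, hβ,
      fun x hx => ⟨mem_iInter.2 fun _ => hx, hx⟩,
      (isFilteredFamily_splittingRep hρ β).unipotentInv, fun x hx v => ?_⟩
    obtain ⟨p, rfl⟩ := (Equiv.ofBijective _ (bijective_splitting hρ x)).surjective v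
    rw [Equiv.symm_apply_apply, Equiv.ofBijective_apply, trivializationAt_splitting hρ hx]
    exact (isUnipotent_splittingRep hρ hx).leftInverse _

end AssociatedGraded

/-! ### The theorem -/

theorem mainTheorem1 {m : ℕ} {M : Type*} [TopologicalSpace M] [T2Space M]
    [SecondCountableTopology M] [ChartedSpace (EuclideanSpace ℝ (Fin m)) M]
    [IsManifold (𝓡 m) ∞ M] {k : ℕ} (d : Fin k → ℕ) (E : M → Type*)
    [TopologicalSpace (TotalSpace (GradedModel d) E)] [∀ x, TopologicalSpace (E x)]
    [FiberBundle (GradedModel d) E] [FilteredBundle m d E] :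
    (∃ V : ∀ i : Fin k, SmoothVectorBundle m M (d i),
      Nonempty (FilteredIso m d d E (WhitneySum V))) ∧
    (Nonempty M → (∃ i, 0 < d i) →
      ∀ (V : ∀ i : Fin k, SmoothVectorBundle m M (d i)) (Φ : FilteredIso m d d E (WhitneySum V)),
        ∃ φ : FilteredIso m d d E E, ¬ WhitneySum.IsGraded (V := V) (fun x v =>
          Φ.toEquiv x (φ.toEquiv x ((Φ.toEquiv x).symm v)))) := by
  refine ⟨?_, fun ⟨x₀⟩ hd V Φ => ?_⟩
  -- With second countability this gives the σ-compactness needed for a partition of unity.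
  · have : LocallyCompactSpace M :=
      ChartedSpace.locallyCompactSpace (EuclideanSpace ℝ (Fin m)) M
    obtain ⟨ρ, hρ⟩ := SmoothPartitionOfUnity.exists_isSubordinate (𝓡 m) isClosed_univ
      (baseSetAt d E) (fun α => (trivializationAt (GradedModel d) E α).open_baseSet)
      fun x _ => mem_iUnion.2 ⟨x, FiberBundle.mem_baseSet_trivializationAt' x⟩
    exact ⟨gradedPiece m d E, ⟨splittingIso hρ⟩⟩
  · obtain ⟨ψ, hψ⟩ := WhitneySum.exists_filteredIso_not_isGraded (V := V) x₀ hd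
    -- Conjugating this automorphism by `Φ` gives back `ψ`.
    refine ⟨(Φ.trans ψ).trans Φ.symm, ?_⟩
    simpa [FilteredIso.trans, FilteredIso.symm] using hψ
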